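/- Let $q$ be a power of an odd prime and let $L$ be a finite-dimensional Lie algebra over the finite field $\mathbb{F}_q$ which is nilpotent of class exactly $3$ and stem, that is, its center satisfies $Z(L)\subseteq [L,L]$. For $x\in L$ let the breadth of $x$ be the codimension in $L$ of the centralizer $C_L(x)=\{y\in L : [x,y]=0\}$. Suppose that, for some integer $m\ge 1$, $L$ has breadth type $(0,2m)$, that is, the set of breadths of elements of $L$ is exactly $\{0,2m\}$. Then $L$ is isomorphic, as a Lie algebra over $\mathbb{F}_q$, to the Lie algebra $\mathfrak{g}_m$ whose underlying vector space is $\mathbb{F}_{q^m}^5$, regarded as a $5m$-dimensional vector space over $\mathbb{F}_q$, with bracket $$[(a,b,c,d,e),(x,y,z,u,v)]=(0,\,0,\,ay-bx,\,ay-bx+2cx-2az,\,ay-bx+2bz-2cy).$$ -/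

import Mathlib

namespace TwoBreadth

section Breadth

variable (k : Type*) {L : Type*} [Field k] [LieRing L] [LieAlgebra k L]

/-- The centralizer `C_L(x) = {y | [x, y] = 0}`, as the kernel of `y ↦ [x, y]`. -/
def centralizer (x : L) : Submodule k L := LinearMap.ker (LieAlgebra.ad k L x)

theorem mem_centralizer (x y : L) : y ∈ centralizer k x ↔ ⁅x, y⁆ = 0 := Iff.rfl

/-- The breadth of `x`: the codimension of its centralizer. -/
noncomputable def breadth (x : L) : ℕ := Module.finrank k (L ⧸ centralizer k x)

variable (L)

/-- `L` has breadth type `(n₀, n₁, …, n_r)`: the `nᵢ` are the distinct breadths of elements of `L`,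
written in increasing order. -/
def HasBreadthType (l : List ℕ) : Prop :=
  l.Pairwise (· < ·) ∧ Set.range (fun x : L => breadth k x) = {n | n ∈ l}

/-- `L` is stem: `Z(L) ⊆ L' = [L, L]`. -/
def IsStem : Prop :=
  LieAlgebra.center k L ≤ ⁅(⊤ : LieIdeal k L), (⊤ : LieIdeal k L)⁆

/-- `L` is `c`-step nilpotent: it is nilpotent of class exactly `c`, i.e. the least `i` such that
the `i`-th term of the lower central series `L⁰ = L`, `Lⁱ = [L, Lⁱ⁻¹]` vanishes is `c`. -/
def IsStepNilpotent (c : ℕ) : Prop :=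
  LieRing.IsNilpotent L ∧ LieModule.nilpotencyLength L L = c

end Breadth

/-- The space `K⁵` underlying the Lie algebra `𝔤_m` (where `K = 𝔽_{q^m}`). -/
def G (K : Type*) : Type _ := Fin 5 → K

namespace G

variable {K : Type*} [Field K]

instance : AddCommGroup (G K) := inferInstanceAs (AddCommGroup (Fin 5 → K))

instance {k : Type*} [Field k] [Algebra k K] : Module k (G K) :=
  inferInstanceAs (Module k (Fin 5 → K))

/-- `[(a,b,c,d,e), (x,y,z,u,v)] = (0, 0, ay-bx, ay-bx+2cx-2az, ay-bx+2bz-2cy)`. -/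
instance : Bracket (G K) (G K) where
  bracket α β :=
    ![0, 0, α 0 * β 1 - α 1 * β 0,
      α 0 * β 1 - α 1 * β 0 + 2 * α 2 * β 0 - 2 * α 0 * β 2,
      α 0 * β 1 - α 1 * β 0 + 2 * α 1 * β 2 - 2 * α 2 * β 1]

@[simp] theorem bracket_zero (α β : G K) : ⁅α, β⁆ 0 = 0 := rfl

@[simp] theorem bracket_one (α β : G K) : ⁅α, β⁆ 1 = 0 := rfl

@[simp] theorem bracket_two (α β : G K) : ⁅α, β⁆ 2 = α 0 * β 1 - α 1 * β 0 := rfl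

@[simp] theorem bracket_three (α β : G K) :
    ⁅α, β⁆ 3 = α 0 * β 1 - α 1 * β 0 + 2 * α 2 * β 0 - 2 * α 0 * β 2 := rfl

@[simp] theorem bracket_four (α β : G K) :
    ⁅α, β⁆ 4 = α 0 * β 1 - α 1 * β 0 + 2 * α 1 * β 2 - 2 * α 2 * β 1 := rfl

@[simp] theorem add_apply (α β : G K) (i : Fin 5) : (α + β) i = α i + β i := rfl

@[simp] theorem zero_apply (i : Fin 5) : (0 : G K) i = 0 := rfl

@[simp] theorem smul_apply {k : Type*} [Field k] [Algebra k K] (t : k) (α : G K) (i : Fin 5) :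
    (t • α) i = t • α i := rfl

theorem ext_coord {K : Type*} {α β : G K} (h0 : α 0 = β 0) (h1 : α 1 = β 1) (h2 : α 2 = β 2)
    (h3 : α 3 = β 3) (h4 : α 4 = β 4) : α = β := by
  funext i
  fin_cases i <;> assumption

instance : LieRing (G K) where
  add_lie α β γ := by apply ext_coord <;> simp <;> ring
  lie_add α β γ := by apply ext_coord <;> simp <;> ring
  lie_self α := by apply ext_coord <;> simp <;> ring
  leibniz_lie α β γ := by apply ext_coord <;> simp <;> ring

instance {k : Type*} [Field k] [Algebra k K] : LieAlgebra k (G K) where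
  lie_smul t α β := by apply ext_coord <;> simp [Algebra.smul_def] <;> ring

end G

end TwoBreadth

/-!
Write `Z` for the center, `A = [L, L] ⊇ Z`, and `n = 2m` for the breadth of the noncentral elements.

If `w = [a, b]` is not central, then `ad w` maps `C(a) + A` into `[a, A]` with kernel of dimension
at most `dim C(w) = dim C(a)`; this forces `C(w) ⊆ C(a) + A` and `[w, C(a)] = [a, A]`
(`centralizer_lie_le`). Hence `C(w)` consists of the elements commuting with both `a` and `b` modulo
`Z`, and this is only the second center (`centralizer_lie_eq_secondCenter`). It follows that
commuting modulo `Z` is an equivalence relation outside the second center, that the second center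
is `A`, and that `dim A / Z = m`: the `m`-dimensional classes form a spread of the `2m`-dimensional
space `V = L / A`.

For fixed `w ∈ A` outside `Z`, each `u ∈ A` yields an endomorphism `R` of `V` with
`[u, x] = [w, R x]`, and `[w, C(x)] = [x, A]` says that `R` preserves every spread component. The
endomorphisms with this property form a division algebra, commutative because its elements are
self-adjoint for the bracket `V × V → A / Z` (`IsSpread.kernel_comm`), and of dimension `m`; being
finite it is `K` (`exists_field_action`). So `V` is a plane over `K`, and the spread consists of its
`K`-lines.

Take a `K`-basis of `V` and lift its two coordinate lines linearly to `s₁, s₂ : K → L` with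
`sᵢ(1)` commuting with `sᵢ(K)`. The relation `[v, t v] ∈ [A, v]` for `v = s₁ x ± s₂ y` splits,
the characteristic being odd, into its even and odd parts in `y`
(`IsFrame.exists_two_smul_eq`), which give `[sᵢ x, sᵢ x'] = 0` and
`[s₁ x, s₂ y] = [s₁ 1, s₂ (x y)]`.
With the Jacobi identity these relations determine the whole bracket: it is that of the free
nilpotent `K`-Lie algebra of class `3` on two generators, which is `G K` after a linear change of
the last two coordinates.
-/

open Module

namespace TwoBreadth

/-! ### Centralizers in class three with a single nonzero breadth -/

section Structure

variable (k L : Type*) [Field k] [LieRing L] [LieAlgebra k L]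

/-- The center of `L` as a `k`-subspace. -/
def ctr : Submodule k L := (LieAlgebra.center k L).toSubmodule

/-- The derived algebra `[L, L]` as a `k`-subspace. -/
def der : Submodule k L := (⁅(⊤ : LieIdeal k L), (⊤ : LieIdeal k L)⁆ : LieIdeal k L).toSubmodule

variable {L}

/-- The elements commuting with `a` modulo the center. -/
def quasiCentralizer (a : L) : Submodule k L := (ctr k L).comap (LieAlgebra.ad k L a)

variable {k}

variable (k L) in
/-- The second center of `L`, the elements that are central modulo the center. -/
def secondCenter : Submodule k L := ⨅ y : L, quasiCentralizer k y

theorem mem_ctr {x : L} : x ∈ ctr k L ↔ ∀ y : L, ⁅x, y⁆ = 0 := by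
  change x ∈ LieAlgebra.center k L ↔ _
  rw [LieModule.mem_maxTrivSubmodule]
  refine forall_congr' fun y => ?_
  rw [← lie_skew, neg_eq_zero]

theorem lie_mem_der (x y : L) : ⁅x, y⁆ ∈ der k L :=
  LieSubmodule.lie_mem_lie (LieSubmodule.mem_top x) (LieSubmodule.mem_top y)

theorem der_le {p : Submodule k L} (h : ∀ x y : L, ⁅x, y⁆ ∈ p) : der k L ≤ p := by
  unfold der
  rw [LieSubmodule.lieIdeal_oper_eq_linear_span', Submodule.span_le]
  rintro _ ⟨x, -, y, -, rfl⟩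
  exact h x y

theorem mem_quasiCentralizer {a x : L} : x ∈ quasiCentralizer k a ↔ ⁅a, x⁆ ∈ ctr k L := Iff.rfl

theorem mem_quasiCentralizer_comm {a x : L} :
    x ∈ quasiCentralizer k a ↔ a ∈ quasiCentralizer k x := by
  rw [mem_quasiCentralizer, mem_quasiCentralizer, ← lie_skew, neg_mem_iff]

theorem mem_secondCenter {x : L} : x ∈ secondCenter k L ↔ ∀ y : L, ⁅x, y⁆ ∈ ctr k L := by
  rw [secondCenter, Submodule.mem_iInf]
  exact forall_congr' fun y => mem_quasiCentralizer_comm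

theorem lie_ctr {z : L} (hz : z ∈ ctr k L) (x : L) : ⁅x, z⁆ = 0 := by
  rw [← lie_skew, mem_ctr.1 hz, neg_zero]

theorem lie_swap_not_mem_ctr {a b : L} (h : ⁅a, b⁆ ∉ ctr k L) : ⁅b, a⁆ ∉ ctr k L := by
  rwa [← lie_skew, neg_mem_iff]

theorem centralizer_eq_of_sub_mem_ctr {u v : L} (h : u - v ∈ ctr k L) :
    centralizer k u = centralizer k v := by
  ext y
  have := mem_ctr.1 h y
  rw [sub_lie, sub_eq_zero] at this
  rw [mem_centralizer, mem_centralizer, this]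

theorem finrank_map_add_finrank_inf_ker {V W : Type*} [AddCommGroup V] [Module k V]
    [AddCommGroup W] [Module k W] [FiniteDimensional k V] (f : V →ₗ[k] W) (p : Submodule k V) :
    finrank k (p.map f) + finrank k (p ⊓ LinearMap.ker f : Submodule k V) = finrank k p := by
  have h := (f.domRestrict p).finrank_range_add_finrank_ker
  rw [LinearMap.range_domRestrict, LinearMap.ker_domRestrict] at h
  rw [← h, ← Submodule.map_comap_subtype]
  congr 1
  exact ((Submodule.equivMapOfInjective p.subtype p.injective_subtype _).finrank_eq).symm

variable (k L) in
/-- The consequences of the hypotheses that drive the argument: `[L, L]` is central modulo the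
center, contains the center properly, and all noncentral elements have breadth `n`. -/
structure IsUniform (n : ℕ) : Prop where
  lie_mem_ctr : ∀ w ∈ der k L, ∀ x : L, ⁅w, x⁆ ∈ ctr k L
  ctr_le : ctr k L ≤ der k L
  exists_not_mem : ∃ w ∈ der k L, w ∉ ctr k L
  breadth_eq : ∀ x : L, x ∉ ctr k L → finrank k (centralizer k x) + n = finrank k L

/-- Three subgroups lemma: the second center centralizes the derived algebra. -/
theorem lie_secondCenter_der {x w : L} (hx : x ∈ secondCenter k L) (hw : w ∈ der k L) :
    ⁅x, w⁆ = 0 := by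
  have : der k L ≤ centralizer k x := der_le fun y z => by
    rw [mem_secondCenter] at hx
    rw [mem_centralizer, leibniz_lie, mem_ctr.1 (hx y), lie_ctr (hx z), add_zero]
  exact this hw

theorem secondCenter_le_centralizer {w : L} (hw : w ∈ der k L) :
    secondCenter k L ≤ centralizer k w := fun x hx => by
  rw [mem_centralizer, ← lie_skew, lie_secondCenter_der hx hw, neg_zero]

theorem secondCenter_le_quasiCentralizer (a : L) : secondCenter k L ≤ quasiCentralizer k a :=
  iInf_le _ a

theorem centralizer_le_quasiCentralizer (a : L) : centralizer k a ≤ quasiCentralizer k a :=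
  fun x hx => by
    rw [mem_quasiCentralizer, (mem_centralizer k a x).1 hx]
    exact zero_mem _

theorem exists_lie_not_mem {a : L} (ha : a ∉ secondCenter k L) : ∃ b, ⁅a, b⁆ ∉ ctr k L := by
  rw [mem_secondCenter] at ha
  push Not at ha
  exact ha

theorem not_mem_secondCenter_of_lie {a b : L} (hab : ⁅a, b⁆ ∉ ctr k L) : a ∉ secondCenter k L :=
  fun ha => hab (mem_secondCenter.1 ha b)

theorem finrank_map_ad_der [FiniteDimensional k L] (a : L) :
    finrank k ((der k L).map (LieAlgebra.ad k L a)) + finrank k (centralizer k a) =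
      finrank k (centralizer k a ⊔ der k L : Submodule k L) := by
  rw [← finrank_map_add_finrank_inf_ker (LieAlgebra.ad k L a) (centralizer k a ⊔ der k L),
    Submodule.map_sup]
  have h1 : (centralizer k a).map (LieAlgebra.ad k L a) = ⊥ := by
    rw [eq_bot_iff]
    rintro _ ⟨c, hc, rfl⟩
    exact hc
  have h2 : (centralizer k a ⊔ der k L) ⊓ LinearMap.ker (LieAlgebra.ad k L a) = centralizer k a :=
    inf_eq_right.2 (le_sup_left (a := centralizer k a))
  rw [h1, h2, bot_sup_eq]

/-- Jacobi: if `c` commutes with `a`, then `[[a, b], c] = [a, [b, c]]`. -/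
theorem lie_lie_of_commute {a b c : L} (hc : ⁅a, c⁆ = 0) : ⁅⁅a, b⁆, c⁆ = ⁅a, ⁅b, c⁆⁆ := by
  rw [lie_lie, hc, lie_zero, sub_zero]

namespace IsUniform

variable {n : ℕ}

theorem der_le_secondCenter (h : IsUniform k L n) : der k L ≤ secondCenter k L := fun w hw =>
  mem_secondCenter.2 (h.lie_mem_ctr w hw)

theorem lie_der_der (h : IsUniform k L n) {u w : L} (hu : u ∈ der k L) (hw : w ∈ der k L) :
    ⁅u, w⁆ = 0 :=
  lie_secondCenter_der (h.der_le_secondCenter hu) hw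

theorem finrank_centralizer_eq (h : IsUniform k L n) {x y : L} (hx : x ∉ ctr k L)
    (hy : y ∉ ctr k L) : finrank k (centralizer k x) = finrank k (centralizer k y) := by
  have := h.breadth_eq x hx
  have := h.breadth_eq y hy
  omega

theorem not_mem_ctr (h : IsUniform k L n) {a : L} (ha : a ∉ secondCenter k L) : a ∉ ctr k L :=
  fun hz => ha (h.der_le_secondCenter (h.ctr_le hz))

theorem exists_lie_not_mem_ctr (h : IsUniform k L n) : ∃ a b : L, ⁅a, b⁆ ∉ ctr k L := by
  by_contra! hc
  obtain ⟨w, hw, hw'⟩ := h.exists_not_mem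
  exact hw' (der_le hc hw)

variable [FiniteDimensional k L]

/-- If `w = [a, b]` is not central, `ad w` maps `C(a) + [L, L]` into `[a, [L, L]]`, and comparing
dimensions of kernels and images shows that `C(w)` lies in `C(a) + [L, L]` and that the image is
all of `[a, [L, L]]`. -/
theorem centralizer_lie_le (h : IsUniform k L n) {a b : L} (hab : ⁅a, b⁆ ∉ ctr k L) :
    centralizer k ⁅a, b⁆ ≤ centralizer k a ⊔ der k L ∧
    (centralizer k a).map (LieAlgebra.ad k L ⁅a, b⁆) =
      (der k L).map (LieAlgebra.ad k L a) := by
  have hle : (centralizer k a).map (LieAlgebra.ad k L ⁅a, b⁆) ≤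
      (der k L).map (LieAlgebra.ad k L a) := by
    rintro _ ⟨c, hc, rfl⟩
    exact ⟨⁅b, c⁆, lie_mem_der b c, (lie_lie_of_commute hc).symm⟩
  have h0 := finrank_map_ad_der (k := k) a
  have h1 := finrank_map_add_finrank_inf_ker (LieAlgebra.ad k L ⁅a, b⁆)
    (centralizer k a ⊔ der k L)
  have h2 : (der k L).map (LieAlgebra.ad k L ⁅a, b⁆) = ⊥ := by
    rw [eq_bot_iff]
    rintro _ ⟨u, hu, rfl⟩
    exact h.lie_der_der (lie_mem_der a b) hu
  rw [Submodule.map_sup, h2, sup_bot_eq] at h1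
  have h3 := Submodule.finrank_mono hle
  have ha : a ∉ ctr k L := h.not_mem_ctr (not_mem_secondCenter_of_lie hab)
  have h4 := h.finrank_centralizer_eq ha hab
  have h5 : finrank k ((centralizer k a ⊔ der k L) ⊓ LinearMap.ker (LieAlgebra.ad k L ⁅a, b⁆) :
      Submodule k L) ≤ finrank k (centralizer k ⁅a, b⁆) :=
    Submodule.finrank_mono inf_le_right
  refine ⟨?_, Submodule.eq_of_le_of_finrank_le hle (by omega)⟩
  have h6 : (centralizer k a ⊔ der k L) ⊓ LinearMap.ker (LieAlgebra.ad k L ⁅a, b⁆) =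
      centralizer k ⁅a, b⁆ :=
    Submodule.eq_of_le_of_finrank_le inf_le_right (by omega)
  exact h6 ▸ inf_le_left

theorem quasiCentralizer_eq_sup (h : IsUniform k L n) {a : L} (ha : a ∉ secondCenter k L) :
    quasiCentralizer k a = centralizer k a ⊔ der k L := by
  obtain ⟨b, hab⟩ := exists_lie_not_mem ha
  apply le_antisymm
  · intro e he
    have h1 : ⁅⁅a, b⁆, e⁆ ∈ (der k L).map (LieAlgebra.ad k L a) := by
      refine ⟨⁅b, e⁆, lie_mem_der b e, ?_⟩
      rw [LieAlgebra.ad_apply, leibniz_lie, lie_ctr (mem_quasiCentralizer.1 he), add_zero]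
    rw [← (h.centralizer_lie_le hab).2] at h1
    obtain ⟨c, hc, hce⟩ := h1
    have h2 : e - c ∈ centralizer k ⁅a, b⁆ := by
      rw [mem_centralizer, lie_sub, ← hce, LieAlgebra.ad_apply, sub_self]
    have h3 := add_mem ((h.centralizer_lie_le hab).1 h2)
      (le_sup_left (b := der k L) (show c ∈ centralizer k a from hc))
    rwa [sub_add_cancel] at h3
  · exact sup_le (centralizer_le_quasiCentralizer a)
      (h.der_le_secondCenter.trans (secondCenter_le_quasiCentralizer a))

theorem centralizer_lie_eq_inf (h : IsUniform k L n) {a b : L} (hab : ⁅a, b⁆ ∉ ctr k L) :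
    centralizer k ⁅a, b⁆ = quasiCentralizer k a ⊓ quasiCentralizer k b := by
  have hba := lie_swap_not_mem_ctr hab
  apply le_antisymm
  · rw [h.quasiCentralizer_eq_sup (not_mem_secondCenter_of_lie hab),
      h.quasiCentralizer_eq_sup (not_mem_secondCenter_of_lie hba)]
    refine le_inf (h.centralizer_lie_le hab).1 ?_
    have : centralizer k ⁅a, b⁆ = centralizer k ⁅b, a⁆ := by
      ext y
      rw [mem_centralizer, mem_centralizer, ← lie_skew a b, neg_lie, neg_eq_zero]
    rw [this]
    exact (h.centralizer_lie_le hba).1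
  · rintro c ⟨ha, hb⟩
    rw [mem_centralizer, lie_lie, lie_ctr (mem_quasiCentralizer.1 ha),
      lie_ctr (mem_quasiCentralizer.1 hb), sub_zero]

/-- If `c` centralizes `[a, b]`, everything commuting with `a` modulo the center commutes with `c`
modulo the center. -/
theorem quasiCentralizer_le_of_mem (h : IsUniform k L n) {a b c : L} (hab : ⁅a, b⁆ ∉ ctr k L)
    (hc : c ∈ centralizer k ⁅a, b⁆) : quasiCentralizer k a ≤ quasiCentralizer k c := by
  intro x hx
  -- `[a, b + x]` and `[a, b]` agree modulo the center, hence have the same centralizer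
  have h1 : ⁅a, b + x⁆ - ⁅a, b⁆ ∈ ctr k L := by
    rw [lie_add, add_sub_cancel_left]; exact hx
  have h2 : ⁅a, b + x⁆ ∉ ctr k L := fun hm => hab (by
    have := sub_mem hm h1
    rwa [sub_sub_cancel] at this)
  have h3 : c ∈ centralizer k ⁅a, b + x⁆ := by rwa [centralizer_eq_of_sub_mem_ctr h1]
  rw [h.centralizer_lie_eq_inf hab] at hc
  rw [h.centralizer_lie_eq_inf h2] at h3
  have h4 := sub_mem (mem_quasiCentralizer_comm.1 h3.2) (mem_quasiCentralizer_comm.1 hc.2)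
  rwa [add_sub_cancel_left] at h4

/-- Suppose `c` centralizes `[a, b]` and `[c, d]` is not central. Every element quasi-commuting
with `a` or `b` does so with `c`, so the centralizers of `[a, d]`, `[b, d]` and `[c, d]` coincide
and lie in that of `[a, b]`. By dimension they equal it and thus contain `c`, which is absurd. -/
theorem centralizer_lie_eq_secondCenter (h : IsUniform k L n) {a b : L}
    (hab : ⁅a, b⁆ ∉ ctr k L) : centralizer k ⁅a, b⁆ = secondCenter k L := by
  refine le_antisymm ?_ (secondCenter_le_centralizer (lie_mem_der a b))
  intro c hc
  by_contra hc2
  obtain ⟨d, hcd⟩ := exists_lie_not_mem hc2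
  have hba := lie_swap_not_mem_ctr hab
  have hc' : c ∈ centralizer k ⁅b, a⁆ := by
    rwa [mem_centralizer, ← lie_skew b a, neg_lie, neg_eq_zero]
  have key : ∀ e, quasiCentralizer k e ≤ quasiCentralizer k c →
      centralizer k ⁅c, d⁆ ≤ quasiCentralizer k e := by
    intro e he
    have hed : ⁅e, d⁆ ∉ ctr k L := fun hm => hcd (he hm)
    have h1 : centralizer k ⁅e, d⁆ = centralizer k ⁅c, d⁆ := by
      refine Submodule.eq_of_le_of_finrank_eq ?_ (h.finrank_centralizer_eq hed hcd)
      rw [h.centralizer_lie_eq_inf hed, h.centralizer_lie_eq_inf hcd]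
      exact inf_le_inf_right _ he
    rw [← h1, h.centralizer_lie_eq_inf hed]
    exact inf_le_left
  have h2 : centralizer k ⁅c, d⁆ = centralizer k ⁅a, b⁆ := by
    refine Submodule.eq_of_le_of_finrank_eq ?_ (h.finrank_centralizer_eq hcd hab)
    rw [h.centralizer_lie_eq_inf hab]
    exact le_inf (key a (h.quasiCentralizer_le_of_mem hab hc))
      (key b (h.quasiCentralizer_le_of_mem hba hc'))
  rw [← h2, h.centralizer_lie_eq_inf hcd] at hc
  exact lie_swap_not_mem_ctr hcd hc.2

theorem finrank_secondCenter (h : IsUniform k L n) :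
    finrank k (secondCenter k L) + n = finrank k L := by
  obtain ⟨a, b, hab⟩ := h.exists_lie_not_mem_ctr
  rw [← h.centralizer_lie_eq_secondCenter hab]
  exact h.breadth_eq _ hab

theorem centralizer_eq_secondCenter (h : IsUniform k L n) {u : L} (hu : u ∈ der k L)
    (hu' : u ∉ ctr k L) : centralizer k u = secondCenter k L := by
  refine (Submodule.eq_of_le_of_finrank_eq (secondCenter_le_centralizer hu) ?_).symm
  have := h.finrank_secondCenter
  have := h.breadth_eq u hu'
  omega

theorem mem_ctr_of_lie_eq_zero (h : IsUniform k L n) {u a : L} (hu : u ∈ der k L)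
    (ha : a ∉ secondCenter k L) (hua : ⁅u, a⁆ = 0) : u ∈ ctr k L := by
  by_contra hu'
  rw [← h.centralizer_eq_secondCenter hu hu'] at ha
  exact ha hua

theorem quasiCentralizer_inf (h : IsUniform k L n) {a b : L} (hab : ⁅a, b⁆ ∉ ctr k L) :
    quasiCentralizer k a ⊓ quasiCentralizer k b = secondCenter k L := by
  rw [← h.centralizer_lie_eq_inf hab, h.centralizer_lie_eq_secondCenter hab]

/-- For `a` outside the second center, elements commuting with `a` modulo the center commute with
each other modulo the center. -/
theorem lie_mem_ctr_of_quasiCentralizer (h : IsUniform k L n) {a x y : L}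
    (ha : a ∉ secondCenter k L) (hx : x ∈ quasiCentralizer k a) (hy : y ∈ quasiCentralizer k a) :
    ⁅x, y⁆ ∈ ctr k L := by
  by_contra hxy
  rw [← h.quasiCentralizer_inf hxy] at ha
  exact ha ⟨mem_quasiCentralizer_comm.1 hx, mem_quasiCentralizer_comm.1 hy⟩

theorem finrank_map_ad (h : IsUniform k L n) {a : L} (ha : a ∉ secondCenter k L) :
    finrank k ((der k L).map (LieAlgebra.ad k L a)) + finrank k (ctr k L) =
      finrank k (der k L) := by
  rw [← finrank_map_add_finrank_inf_ker (LieAlgebra.ad k L a) (der k L)]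
  suffices ctr k L = der k L ⊓ LinearMap.ker (LieAlgebra.ad k L a) by rw [← this]
  ext u
  refine ⟨fun hu => ⟨h.ctr_le hu, lie_ctr hu a⟩, fun hu => ?_⟩
  refine h.mem_ctr_of_lie_eq_zero hu.1 ha ?_
  rw [← lie_skew, neg_eq_zero]
  exact hu.2

theorem finrank_quasiCentralizer (h : IsUniform k L n) {a : L} (ha : a ∉ secondCenter k L) :
    finrank k (quasiCentralizer k a) + finrank k (ctr k L) =
      finrank k (der k L) + finrank k (secondCenter k L) := by
  have h1 := finrank_map_ad_der (k := k) a
  rw [← h.quasiCentralizer_eq_sup ha] at h1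
  have h2 := h.finrank_map_ad ha
  have h3 := h.breadth_eq a (h.not_mem_ctr ha)
  have h4 := h.finrank_secondCenter
  omega

theorem range_ad_inf_ctr (h : IsUniform k L n) {a : L} (ha : a ∉ secondCenter k L) :
    LinearMap.range (LieAlgebra.ad k L a) ⊓ ctr k L = (der k L).map (LieAlgebra.ad k L a) := by
  apply le_antisymm
  · rintro _ ⟨⟨c, rfl⟩, hc⟩
    have hc' : c ∈ quasiCentralizer k a := hc
    rw [h.quasiCentralizer_eq_sup ha] at hc'
    obtain ⟨c0, hc0, u, hu, rfl⟩ := Submodule.mem_sup.1 hc'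
    refine ⟨u, hu, ?_⟩
    rw [map_add, LieAlgebra.ad_apply, LieAlgebra.ad_apply, (mem_centralizer k a c0).1 hc0, zero_add]
  · rintro _ ⟨u, hu, rfl⟩
    refine ⟨⟨u, rfl⟩, ?_⟩
    exact mem_quasiCentralizer.1 (mem_quasiCentralizer_comm.1
      (mem_secondCenter.1 (h.der_le_secondCenter hu) a))

/-- The two inequalities come from `quasiCentralizer a ⊔ quasiCentralizer b ≤ ⊤` and from
`[a, L] + Z(L) ≤ [L, L]`. -/
theorem two_mul_finrank_der (h : IsUniform k L n) :
    2 * finrank k (der k L) = 2 * finrank k (ctr k L) + n := by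
  obtain ⟨a, b, hab⟩ := h.exists_lie_not_mem_ctr
  have ha := not_mem_secondCenter_of_lie hab
  have hb := not_mem_secondCenter_of_lie (lie_swap_not_mem_ctr hab)
  have h1 := h.finrank_quasiCentralizer ha
  have h2 := h.finrank_quasiCentralizer hb
  have h3 := Submodule.finrank_sup_add_finrank_inf_eq (quasiCentralizer k a) (quasiCentralizer k b)
  rw [h.quasiCentralizer_inf hab] at h3
  have h4 := Submodule.finrank_le (quasiCentralizer k a ⊔ quasiCentralizer k b)
  have h5 := h.finrank_secondCenter
  have h6 := Submodule.finrank_sup_add_finrank_inf_eq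
    (LinearMap.range (LieAlgebra.ad k L a)) (ctr k L)
  rw [h.range_ad_inf_ctr ha] at h6
  have h7 := h.finrank_map_ad ha
  have h8 := (LieAlgebra.ad k L a).finrank_range_add_finrank_ker
  have h9 : finrank k (LinearMap.ker (LieAlgebra.ad k L a)) + n = finrank k L :=
    h.breadth_eq a (h.not_mem_ctr ha)
  have h10 : LinearMap.range (LieAlgebra.ad k L a) ⊔ ctr k L ≤ der k L := by
    refine sup_le ?_ h.ctr_le
    rintro _ ⟨c, rfl⟩
    exact lie_mem_der a c
  have h11 := Submodule.finrank_mono h10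
  omega

theorem range_ad_sup_ctr (h : IsUniform k L n) {a : L} (ha : a ∉ secondCenter k L) :
    LinearMap.range (LieAlgebra.ad k L a) ⊔ ctr k L = der k L := by
  have h6 := Submodule.finrank_sup_add_finrank_inf_eq
    (LinearMap.range (LieAlgebra.ad k L a)) (ctr k L)
  rw [h.range_ad_inf_ctr ha] at h6
  have h7 := h.finrank_map_ad ha
  have h8 := (LieAlgebra.ad k L a).finrank_range_add_finrank_ker
  have h9 : finrank k (LinearMap.ker (LieAlgebra.ad k L a)) + n = finrank k L :=
    h.breadth_eq a (h.not_mem_ctr ha)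
  have h12 := h.two_mul_finrank_der
  refine Submodule.eq_of_le_of_finrank_eq (sup_le ?_ h.ctr_le) (by omega)
  rintro _ ⟨c, rfl⟩
  exact lie_mem_der a c

theorem quasiCentralizer_sup (h : IsUniform k L n) {a b : L} (hab : ⁅a, b⁆ ∉ ctr k L) :
    quasiCentralizer k a ⊔ quasiCentralizer k b = ⊤ := by
  have h1 := h.finrank_quasiCentralizer (not_mem_secondCenter_of_lie hab)
  have h2 := h.finrank_quasiCentralizer
    (not_mem_secondCenter_of_lie (lie_swap_not_mem_ctr hab))
  have h3 := Submodule.finrank_sup_add_finrank_inf_eq (quasiCentralizer k a) (quasiCentralizer k b)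
  rw [h.quasiCentralizer_inf hab] at h3
  have h5 := h.finrank_secondCenter
  have h12 := h.two_mul_finrank_der
  exact Submodule.eq_top_of_finrank_eq (by omega)

/-- For noncentral `w ∈ [L, L]`, the map `ad w` sends `C(a)` onto `[a, [L, L]]`. -/
theorem exists_lie_eq (h : IsUniform k L n) {w u a : L} (hw : w ∈ der k L) (hw' : w ∉ ctr k L)
    (hu : u ∈ der k L) : ∃ c, ⁅a, c⁆ = 0 ∧ ⁅w, c⁆ = ⁅u, a⁆ := by
  by_cases ha : a ∈ secondCenter k L
  · refine ⟨0, lie_zero a, ?_⟩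
    rw [lie_zero, ← lie_skew, lie_secondCenter_der ha hu, neg_zero]
  have hw2 := hw
  rw [← h.range_ad_sup_ctr ha] at hw2
  obtain ⟨_, ⟨b, rfl⟩, z, hz, rfl⟩ := Submodule.mem_sup.1 hw2
  rw [LieAlgebra.ad_apply] at hw' ⊢
  have hab : ⁅a, b⁆ ∉ ctr k L := fun hm => hw' (add_mem hm hz)
  have hm : ⁅u, a⁆ ∈ (der k L).map (LieAlgebra.ad k L a) :=
    ⟨-u, neg_mem hu, by rw [LieAlgebra.ad_apply, lie_neg, lie_skew]⟩
  rw [← (h.centralizer_lie_le hab).2] at hm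
  obtain ⟨c, hc, hcu⟩ := hm
  exact ⟨c, hc, by rw [add_lie, mem_ctr.1 hz, add_zero, ← hcu, LieAlgebra.ad_apply]⟩

/-- The subspaces `[[L, L], a]` and `[[L, L], b]` meet trivially when `[a, b]` is not central: if
`v` is noncentral, then `[u, a] = [v, c]` for some `c` commuting with `a`, so that `b - c`
centralizes `v` and thus commutes with `a` modulo the center. -/
theorem lie_eq_lie (h : IsUniform k L n) {a b u v : L} (hab : ⁅a, b⁆ ∉ ctr k L)
    (hu : u ∈ der k L) (hv : v ∈ der k L) (huv : ⁅u, a⁆ = ⁅v, b⁆) :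
    u ∈ ctr k L ∧ v ∈ ctr k L := by
  have ha := not_mem_secondCenter_of_lie hab
  have hv' : v ∈ ctr k L := by
    by_contra hv'
    obtain ⟨c, hac, hc⟩ := h.exists_lie_eq (a := a) hv hv' hu
    have h1 : b - c ∈ centralizer k v := by
      rw [mem_centralizer, lie_sub, hc, huv, sub_self]
    rw [h.centralizer_eq_secondCenter hv hv'] at h1
    have h2 := secondCenter_le_quasiCentralizer a h1
    rw [mem_quasiCentralizer, lie_sub, hac, sub_zero] at h2
    exact hab h2
  refine ⟨h.mem_ctr_of_lie_eq_zero hu ha ?_, hv'⟩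
  rw [huv, mem_ctr.1 hv']

theorem lie_add_lie (h : IsUniform k L n) {a b u v : L} (hab : ⁅a, b⁆ ∉ ctr k L)
    (hu : u ∈ der k L) (hv : v ∈ der k L) (huv : ⁅u, a⁆ + ⁅v, b⁆ = 0) :
    u ∈ ctr k L ∧ v ∈ ctr k L := by
  have := h.lie_eq_lie hab hu (neg_mem hv) (by rw [neg_lie, eq_neg_iff_add_eq_zero, huv])
  rwa [neg_mem_iff] at this

/-- If `x` lies in the second center, then for each `b` outside it some `u ∈ [L, L]` satisfies
`[b, x] = [b, u]`. By `lie_add_lie` this `u` does not depend on `b` modulo the center, so that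
`x - u` is central. -/
theorem secondCenter_eq_der (h : IsUniform k L n) : secondCenter k L = der k L := by
  refine le_antisymm (fun x hx => ?_) h.der_le_secondCenter
  have hex : ∀ y, y ∉ secondCenter k L → ∃ u ∈ der k L, ⁅y, x⁆ = ⁅y, u⁆ := by
    intro y hy
    have := secondCenter_le_quasiCentralizer y hx
    rw [h.quasiCentralizer_eq_sup hy] at this
    obtain ⟨c, hc, u, hu, rfl⟩ := Submodule.mem_sup.1 this
    exact ⟨u, hu, by rw [lie_add, (mem_centralizer k y c).1 hc, zero_add]⟩
  obtain ⟨a, b0, hab0⟩ := h.exists_lie_not_mem_ctr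
  obtain ⟨u, hu, hau⟩ := hex a (not_mem_secondCenter_of_lie hab0)
  have h1 : ∀ b, ⁅a, b⁆ ∉ ctr k L → ⁅b, x - u⁆ = 0 := by
    intro b hab
    have hs : ⁅a + b, b⁆ ∉ ctr k L := by rwa [add_lie, lie_self, add_zero]
    obtain ⟨v, hv, hbv⟩ := hex b
      (not_mem_secondCenter_of_lie (lie_swap_not_mem_ctr hab))
    obtain ⟨w, hw, habw⟩ := hex (a + b) (not_mem_secondCenter_of_lie hs)
    rw [add_lie, add_lie, hau, hbv] at habw
    have h2 := h.lie_add_lie hab (sub_mem hu hw) (sub_mem hv hw) (by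
      rw [sub_lie, sub_lie, ← lie_skew u a, ← lie_skew w a, ← lie_skew v b, ← lie_skew w b,
        ← neg_eq_zero, ← sub_eq_zero.2 habw]
      abel)
    have h3 : v - u ∈ ctr k L := by
      have := sub_mem h2.2 h2.1
      rwa [sub_sub_sub_cancel_right] at this
    have h4 := lie_ctr h3 b
    rwa [lie_sub, ← hbv, ← lie_sub] at h4
  have h2 : x - u ∈ ctr k L := by
    rw [mem_ctr]
    intro c
    rw [← lie_skew, neg_eq_zero]
    by_cases hc : ⁅a, c⁆ ∈ ctr k L
    · have h3 : ⁅a, b0 + c⁆ ∉ ctr k L := by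
        rw [lie_add]
        exact fun hm => hab0 ((Submodule.add_mem_iff_left _ hc).1 hm)
      have h4 := h1 _ h3
      rwa [add_lie, h1 _ hab0, zero_add] at h4
    · exact h1 c hc
  have := add_mem (h.ctr_le h2) hu
  rwa [sub_add_cancel] at this

end IsUniform
end Structure

/-! ### Spreads and their kernels -/

section Spread

variable {k V U : Type*} [Field k] [AddCommGroup V] [Module k V] [AddCommGroup U] [Module k U]

/-- An alternating map `ω` for which the relation `ω x y = 0` is transitive on nonzero vectors and
which is nondegenerate. Then the subspaces `{x | ω v x = 0}`, `v ≠ 0`, form a partition of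
the nonzero vectors of `V`. -/
structure IsSpread (ω : V →ₗ[k] V →ₗ[k] U) : Prop where
  self_eq_zero : ∀ v, ω v v = 0
  trans : ∀ v x y, v ≠ 0 → ω v x = 0 → ω v y = 0 → ω x y = 0
  exists_ne_zero : ∀ v, v ≠ 0 → ∃ x, ω v x ≠ 0

namespace IsSpread

variable {ω : V →ₗ[k] V →ₗ[k] U}

theorem neg_swap (h : IsSpread ω) (v w : V) : -ω v w = ω w v := by
  have := h.self_eq_zero (v + w)
  rw [map_add ω, LinearMap.add_apply, map_add, map_add, h.self_eq_zero, h.self_eq_zero, zero_add,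
    add_zero] at this
  exact (eq_neg_of_add_eq_zero_right this).symm

theorem swap_eq_zero (h : IsSpread ω) {v w : V} (hvw : ω v w = 0) : ω w v = 0 := by
  rw [← h.neg_swap, hvw, neg_zero]

/-- The kernel of the spread: the endomorphisms preserving all subspaces `{x | ω v x = 0}`. -/
def kernel (h : IsSpread ω) : Subalgebra k (End k V) where
  carrier := {R | ∀ v, ω v (R v) = 0}
  mul_mem' {R S} hR hS v := by
    by_cases hv : S v = 0
    · rw [End.mul_apply, hv, map_zero, map_zero]
    · exact h.trans (S v) _ _ hv (h.swap_eq_zero (hS v)) (hR (S v))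
  add_mem' {R S} hR hS v := by
    rw [LinearMap.add_apply, map_add, hR, hS, add_zero]
  algebraMap_mem' r v := by
    rw [Module.algebraMap_end_apply, map_smul, h.self_eq_zero, smul_zero]

theorem apply_left_eq (h : IsSpread ω) {R : End k V} (hR : R ∈ h.kernel) (v w : V) :
    ω (R v) w = ω v (R w) := by
  have := hR (v + w)
  rw [map_add R, map_add ω, LinearMap.add_apply, map_add, map_add, hR, hR, zero_add,
    add_zero] at this
  rw [← h.neg_swap w, eq_comm, eq_neg_iff_add_eq_zero, this]

theorem eq_zero_of_forall (h : IsSpread ω) {x : V} (hx : ∀ v, ω v x = 0) : x = 0 := by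
  by_contra hx0
  obtain ⟨y, hy⟩ := h.exists_ne_zero x hx0
  exact hy (h.swap_eq_zero (hx y))

/-- Elements of the kernel are self-adjoint for `ω`, so their products in both orders agree. -/
theorem kernel_comm (h : IsSpread ω) {R S : End k V} (hR : R ∈ h.kernel) (hS : S ∈ h.kernel) :
    R * S = S * R := by
  ext w
  rw [← sub_eq_zero]
  refine h.eq_zero_of_forall fun v => ?_
  rw [map_sub, sub_eq_zero, ← h.apply_left_eq (mul_mem hS hR), End.mul_apply, End.mul_apply,
    h.apply_left_eq hS, h.apply_left_eq hR]

/-- A kernel element `R` vanishing at `v` maps each `x` in another component into the components of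
both `x` and `v + x`, which meet trivially. -/
theorem kernel_eq_zero (h : IsSpread ω) {R : End k V} (hR : R ∈ h.kernel) {v : V} (hv : v ≠ 0)
    (hRv : R v = 0) : R = 0 := by
  have key : ∀ x, ω v x ≠ 0 → R x = 0 := by
    intro x hx
    by_contra hRx
    have h1 := hR (v + x)
    rw [map_add R, map_add ω, LinearMap.add_apply, hRv, zero_add, hR, add_zero] at h1
    exact hx (h.trans (R x) v x hRx (h.swap_eq_zero h1) (h.swap_eq_zero (hR x)))
  obtain ⟨y, hy⟩ := h.exists_ne_zero v hv
  ext x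
  by_cases hx : ω v x = 0
  · have := key (x + y) (by rwa [map_add, hx, zero_add])
    rwa [map_add, key y hy, add_zero] at this
  · exact key x hx

/-- Over a finite field, the kernel of a spread whose components have dimension `m` is an
extension field of degree `m` as soon as it contains an `m`-dimensional space of endomorphisms,
and finite fields are determined by their degree. -/
theorem exists_algHom [Finite k] [FiniteDimensional k V] [Nontrivial V] (h : IsSpread ω) {m : ℕ}
    (hm : ∀ v ≠ 0, finrank k (LinearMap.ker (ω v)) = m)
    (E : Submodule k (End k V)) (hE : ∀ R ∈ E, ∀ v, ω v (R v) = 0) (hEm : m ≤ finrank k E)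
    {K : Type*} [Field K] [Algebra k K] (hK : finrank k K = m) :
    ∃ R : K →ₐ[k] End k V, ∀ t v, ω v (R t v) = 0 := by
  let : CommRing h.kernel :=
    { (inferInstance : Ring h.kernel) with
      mul_comm := fun R S => Subtype.ext (h.kernel_comm R.2 S.2) }
  have : NoZeroDivisors h.kernel := ⟨fun {R S} hRS => by
    by_contra! hc
    have hS : ∃ v, S.1 v ≠ 0 := by
      by_contra! hz
      exact hc.2 (Subtype.ext (LinearMap.ext hz))
    obtain ⟨v, hv⟩ := hS
    exact hc.1 (Subtype.ext (h.kernel_eq_zero R.2 hv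
      (LinearMap.congr_fun (congrArg Subtype.val hRS) v)))⟩
  have : IsDomain h.kernel := NoZeroDivisors.to_isDomain _
  let : Field h.kernel := fieldOfFiniteDimensional k h.kernel
  have hfin : finrank k h.kernel = m := by
    apply le_antisymm
    · obtain ⟨v, hv⟩ := exists_ne (0 : V)
      rw [← hm v hv]
      let f : h.kernel →ₗ[k] LinearMap.ker (ω v) :=
        { toFun := fun R => ⟨R.1 v, R.2 v⟩
          map_add' := fun _ _ => rfl
          map_smul' := fun _ _ => rfl }
      refine LinearMap.finrank_le_finrank_of_injective (f := f) ?_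
      rw [injective_iff_map_eq_zero]
      exact fun R hR => Subtype.ext (h.kernel_eq_zero R.2 hv (congrArg Subtype.val hR))
    · exact hEm.trans (Submodule.finrank_mono (t := Subalgebra.toSubmodule h.kernel) hE)
  have : Finite h.kernel := Module.finite_of_finite k
  obtain ⟨g⟩ := FiniteField.nonempty_algHom_of_finrank_dvd (F := k) (K := K) (L := h.kernel)
    (by rw [hK, hfin])
  exact ⟨h.kernel.val.comp g, fun t => (g t).2⟩

end IsSpread

end Spread

/-! ### The action of the field on `L / [L, L]` -/

section FieldAction

variable {k L : Type*} [Field k] [LieRing L] [LieAlgebra k L] {n : ℕ}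

namespace IsUniform

/-- The bracket `L/[L, L] × L/[L, L] → L/Z(L)`. -/
def quotBracket (h : IsUniform k L n) :
    (L ⧸ der k L) →ₗ[k] (L ⧸ der k L) →ₗ[k] (L ⧸ ctr k L) :=
  LinearMap.liftQ₂ (der k L) (der k L)
    ((LieAlgebra.ad k L : L →ₗ[k] Module.End k L).compr₂ (ctr k L).mkQ)
    (fun w hw => by
      ext x
      exact (Submodule.Quotient.mk_eq_zero _).2 (h.lie_mem_ctr w hw x))
    (fun w hw => by
      ext x
      exact (Submodule.Quotient.mk_eq_zero _).2
        (mem_quasiCentralizer_comm.1 (h.lie_mem_ctr w hw x)))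

theorem quotBracket_mk (h : IsUniform k L n) (x y : L) :
    h.quotBracket (Submodule.Quotient.mk x) (Submodule.Quotient.mk y) =
      Submodule.Quotient.mk ⁅x, y⁆ := rfl

theorem quotBracket_mk_eq_zero (h : IsUniform k L n) (x y : L) :
    h.quotBracket (Submodule.Quotient.mk x) (Submodule.Quotient.mk y) = 0 ↔ ⁅x, y⁆ ∈ ctr k L := by
  rw [quotBracket_mk, Submodule.Quotient.mk_eq_zero]

variable [FiniteDimensional k L]

theorem not_mem_secondCenter_of_mk_ne_zero (h : IsUniform k L n) {a : L}
    (ha : (Submodule.Quotient.mk a : L ⧸ der k L) ≠ 0) : a ∉ secondCenter k L := by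
  rwa [h.secondCenter_eq_der, ← Submodule.Quotient.mk_eq_zero]

theorem isSpread (h : IsUniform k L n) : IsSpread h.quotBracket where
  self_eq_zero v := by
    obtain ⟨a, rfl⟩ := Submodule.Quotient.mk_surjective _ v
    rw [quotBracket_mk_eq_zero, lie_self]
    exact zero_mem _
  trans v x y hv hx hy := by
    obtain ⟨v, rfl⟩ := Submodule.Quotient.mk_surjective _ v
    obtain ⟨x, rfl⟩ := Submodule.Quotient.mk_surjective _ x
    obtain ⟨y, rfl⟩ := Submodule.Quotient.mk_surjective _ y
    rw [quotBracket_mk_eq_zero] at *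
    exact h.lie_mem_ctr_of_quasiCentralizer (h.not_mem_secondCenter_of_mk_ne_zero hv) hx hy
  exists_ne_zero v hv := by
    obtain ⟨v, rfl⟩ := Submodule.Quotient.mk_surjective _ v
    obtain ⟨b, hb⟩ := exists_lie_not_mem (h.not_mem_secondCenter_of_mk_ne_zero hv)
    exact ⟨Submodule.Quotient.mk b, fun hm => hb ((h.quotBracket_mk_eq_zero v b).1 hm)⟩

theorem finrank_der (h : IsUniform k L n) {m : ℕ} (hn : n = 2 * m) :
    finrank k (der k L) = finrank k (ctr k L) + m := by
  have := h.two_mul_finrank_der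
  omega

theorem finrank_quasiCentralizer_eq (h : IsUniform k L n) {m : ℕ} (hn : n = 2 * m) {a : L}
    (ha : a ∉ secondCenter k L) :
    finrank k (quasiCentralizer k a) = finrank k (der k L) + m := by
  have h1 := h.finrank_quasiCentralizer ha
  have h2 := h.finrank_der hn
  rw [h.secondCenter_eq_der] at h1
  omega

theorem finrank_ker_quotBracket (h : IsUniform k L n) {m : ℕ} (hn : n = 2 * m)
    {v : L ⧸ der k L} (hv : v ≠ 0) : finrank k (LinearMap.ker (h.quotBracket v)) = m := by
  obtain ⟨a, rfl⟩ := Submodule.Quotient.mk_surjective _ v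
  have h1 : (quasiCentralizer k a).map (der k L).mkQ =
      LinearMap.ker (h.quotBracket (Submodule.Quotient.mk a)) := by
    ext x
    obtain ⟨x, rfl⟩ := Submodule.Quotient.mk_surjective _ x
    rw [LinearMap.mem_ker, quotBracket_mk_eq_zero]
    constructor
    · rintro ⟨y, hy, hxy⟩
      rw [← quotBracket_mk_eq_zero h, ← hxy]
      exact (h.quotBracket_mk_eq_zero a y).2 hy
    · exact fun hx => ⟨x, hx, rfl⟩
  have h2 := finrank_map_add_finrank_inf_ker (der k L).mkQ (quasiCentralizer k a)
  have h3 : der k L ≤ quasiCentralizer k a :=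
    h.der_le_secondCenter.trans (secondCenter_le_quasiCentralizer a)
  rw [h1, Submodule.ker_mkQ, inf_eq_right.2 h3,
    h.finrank_quasiCentralizer_eq hn (h.not_mem_secondCenter_of_mk_ne_zero hv)] at h2
  omega

/-- An `m`-dimensional space of endomorphisms of `L/[L, L]` in the kernel of the spread: for a
fixed noncentral `w ∈ [L, L]`, each `u ∈ [L, L]` gives the endomorphism `R` determined by
`[u, x] = [w, R x]`. -/
theorem exists_submodule_kernel (h : IsUniform k L n) {m : ℕ} (hn : n = 2 * m) :
    ∃ E : Submodule k (End k (L ⧸ der k L)),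
      (∀ R ∈ E, ∀ v, h.quotBracket v (R v) = 0) ∧ m ≤ finrank k E := by
  obtain ⟨w, hw, hw'⟩ := h.exists_not_mem
  have hle : ∀ u ∈ der k L, der k L ≤ LinearMap.ker (LieAlgebra.ad k L u) :=
    fun u hu v hv => h.lie_der_der hu hv
  let T : der k L →ₗ[k] (L ⧸ der k L) →ₗ[k] L :=
    { toFun := fun u => (der k L).liftQ (LieAlgebra.ad k L u) (hle u u.2)
      map_add' := fun u v => by
        ext x
        exact add_lie _ _ _
      map_smul' := fun t u => by
        ext x
        exact smul_lie _ _ _ }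
  have hTmk : ∀ u x, T u (Submodule.Quotient.mk x) = ⁅(u : L), x⁆ := fun u x => rfl
  have hinj : LinearMap.ker (T ⟨w, hw⟩) = ⊥ := by
    rw [LinearMap.ker_eq_bot']
    intro v hv
    obtain ⟨x, rfl⟩ := Submodule.Quotient.mk_surjective _ v
    have hx : x ∈ centralizer k w := hv
    rwa [h.centralizer_eq_secondCenter hw hw', h.secondCenter_eq_der,
      ← Submodule.Quotient.mk_eq_zero] at hx
  obtain ⟨P, hP⟩ := LinearMap.exists_leftInverse_of_injective _ hinj
  let ρ : der k L →ₗ[k] End k (L ⧸ der k L) := T.compr₂ P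
  have hρ : ∀ (u : der k L) (x : L), ∃ c : L, ⁅x, c⁆ = 0 ∧ ⁅w, c⁆ = ⁅(u : L), x⁆ ∧
      ρ u (Submodule.Quotient.mk x) = Submodule.Quotient.mk c := by
    intro u x
    obtain ⟨c, hc, hcw⟩ := h.exists_lie_eq (a := x) hw hw' u.2
    refine ⟨c, hc, hcw, ?_⟩
    have h1 : ρ u (Submodule.Quotient.mk x) = P ⁅(u : L), x⁆ := rfl
    rw [h1, ← hcw]
    exact LinearMap.congr_fun hP (Submodule.Quotient.mk c)
  refine ⟨LinearMap.range ρ, ?_, ?_⟩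
  · rintro _ ⟨u, rfl⟩ v
    obtain ⟨x, rfl⟩ := Submodule.Quotient.mk_surjective _ v
    obtain ⟨c, hc, -, hcx⟩ := hρ u x
    rw [hcx, quotBracket_mk, hc]
    rfl
  · have h1 := ρ.finrank_range_add_finrank_ker
    have h2 : (LinearMap.ker ρ).map (der k L).subtype ≤ ctr k L := by
      rintro _ ⟨u, hu, rfl⟩
      rw [mem_ctr]
      intro x
      obtain ⟨c, -, hcw, hcx⟩ := hρ u x
      rw [LinearMap.mem_ker.1 hu, LinearMap.zero_apply, eq_comm, Submodule.Quotient.mk_eq_zero]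
        at hcx
      rw [Submodule.subtype_apply, ← hcw, h.lie_der_der hw hcx]
    have h3 := Submodule.finrank_mono h2
    rw [Submodule.finrank_map_subtype_eq] at h3
    have h4 := h.finrank_der hn
    omega

theorem exists_field_action [Finite k] (h : IsUniform k L n) {m : ℕ} (hn : n = 2 * m)
    {K : Type*} [Field K] [Algebra k K] (hK : finrank k K = m) :
    ∃ R : K →ₐ[k] End k (L ⧸ der k L), ∀ t v, h.quotBracket v (R t v) = 0 := by
  obtain ⟨E, hE, hEm⟩ := h.exists_submodule_kernel hn
  obtain ⟨a, b, hab⟩ := h.exists_lie_not_mem_ctr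
  have ha := not_mem_secondCenter_of_lie hab
  rw [h.secondCenter_eq_der, ← Submodule.Quotient.mk_eq_zero] at ha
  have : Nontrivial (L ⧸ der k L) := ⟨_, _, ha⟩
  exact h.isSpread.exists_algHom (fun v hv => h.finrank_ker_quotBracket hn hv) E hE hEm hK

end IsUniform

end FieldAction

/-! ### Coordinates on the Lie algebra -/

section Frame

variable {k K L : Type*} [Field k] [Field K] [Algebra k K] [LieRing L] [LieAlgebra k L]

/-- Two `k`-linear copies `s₁(K)`, `s₂(K)` of `K` in `L` which lift a pair of `K`-coordinate lines
of `L / [L, L]`, where `K` acts in such a way that `v` and `t v` commute modulo the center for all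
`t ∈ K`. The lifts are normalized by requiring `sᵢ(1)` to commute with `sᵢ(K)`. -/
structure IsFrame (s₁ s₂ : K →ₗ[k] L) : Prop where
  lie_mul_mem : ∀ t x y, ∃ w ∈ der k L,
    ⁅s₁ x + s₂ y, s₁ (t * x) + s₂ (t * y)⁆ = ⁅w, s₁ x + s₂ y⁆
  lie_one_left : ∀ t, ⁅s₁ 1, s₁ t⁆ = 0
  lie_one_right : ∀ t, ⁅s₂ 1, s₂ t⁆ = 0
  lie_not_mem : ∀ x y, x ≠ 0 → y ≠ 0 → ⁅s₁ x, s₂ y⁆ ∉ ctr k L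
  span : ∀ v, ∃ x y, v - (s₁ x + s₂ y) ∈ der k L

section Construction

variable {n : ℕ} [FiniteDimensional k L]

/-- The line `K a` of `L / [L, L]` lifts to the centralizer of `a`. -/
theorem IsUniform.exists_section (h : IsUniform k L n) (R : K →ₐ[k] End k (L ⧸ der k L))
    (hR : ∀ t v, h.quotBracket v (R t v) = 0) {a : L} (ha : a ∉ secondCenter k L) :
    ∃ s : K →ₗ[k] L,
      (∀ t, (Submodule.Quotient.mk (s t) : L ⧸ der k L) = R t (Submodule.Quotient.mk a)) ∧
        ∀ t, ⁅s 1, s t⁆ = 0 := by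
  have hex : ∀ t, ∃ c, ⁅a, c⁆ = 0 ∧
      (Submodule.Quotient.mk c : L ⧸ der k L) = R t (Submodule.Quotient.mk a) := by
    intro t
    obtain ⟨y, hy⟩ := Submodule.Quotient.mk_surjective _ (R t (Submodule.Quotient.mk a))
    have h1 := hR t (Submodule.Quotient.mk a)
    rw [← hy, h.quotBracket_mk_eq_zero, ← mem_quasiCentralizer, h.quasiCentralizer_eq_sup ha] at h1
    obtain ⟨c, hc, u, hu, hcu⟩ := Submodule.mem_sup.1 h1
    refine ⟨c, hc, ?_⟩
    rw [← hy, ← hcu, eq_comm, Submodule.Quotient.eq, add_sub_cancel_left]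
    exact hu
  choose c hc hcR using hex
  let b := Module.Free.chooseBasis k K
  let s : K →ₗ[k] L := b.constr k fun i => c (b i)
  have h1 : (LieAlgebra.ad k L a) ∘ₗ s = 0 := b.ext fun i => by
    rw [LinearMap.comp_apply, b.constr_basis]
    exact hc _
  have h2 : (der k L).mkQ ∘ₗ s = R.toLinearMap.flip (Submodule.Quotient.mk a) := b.ext fun i => by
    rw [LinearMap.comp_apply, b.constr_basis]
    exact hcR _
  have h3 : ∀ t, ⁅a, s t⁆ = 0 := fun t => LinearMap.congr_fun h1 t
  have h4 : ∀ t, (Submodule.Quotient.mk (s t) : L ⧸ der k L) = R t (Submodule.Quotient.mk a) :=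
    fun t => LinearMap.congr_fun h2 t
  refine ⟨s, h4, fun t => ?_⟩
  have h5 : s 1 - a ∈ der k L := by
    rw [← Submodule.Quotient.eq, h4, map_one, End.one_apply]
  have h6 : s 1 - a ∈ ctr k L := by
    refine h.mem_ctr_of_lie_eq_zero h5 ha ?_
    rw [sub_lie, lie_self, sub_zero, ← lie_skew, h3, neg_zero]
  have h7 := mem_ctr.1 h6 (s t)
  rwa [sub_lie, h3, sub_zero] at h7

theorem IsUniform.exists_isFrame [Finite k] (h : IsUniform k L n) {m : ℕ} (hn : n = 2 * m)
    (hm : 1 ≤ m) (hK : finrank k K = m) : ∃ s₁ s₂ : K →ₗ[k] L, IsFrame s₁ s₂ := by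
  obtain ⟨R, hR⟩ := h.exists_field_action hn hK
  obtain ⟨a, b, hab⟩ := h.exists_lie_not_mem_ctr
  have ha := not_mem_secondCenter_of_lie hab
  have hb := not_mem_secondCenter_of_lie (lie_swap_not_mem_ctr hab)
  have : FiniteDimensional k K := Module.finite_of_finrank_pos (by omega)
  have hlift : ∀ {t v w}, (Submodule.Quotient.mk w : L ⧸ der k L) = R t (Submodule.Quotient.mk v) →
      w ∈ quasiCentralizer k v := by
    intro t v w hw
    rw [mem_quasiCentralizer, ← h.quotBracket_mk_eq_zero, hw]
    exact hR t _
  -- nonzero elements of `K` act injectively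
  have hinj : ∀ {x : K} {c s : L}, c ∉ secondCenter k L → x ≠ 0 →
      (Submodule.Quotient.mk s : L ⧸ der k L) = R x (Submodule.Quotient.mk c) →
      s ∉ secondCenter k L := by
    intro x c s hc hx hs hs2
    rw [h.secondCenter_eq_der, ← Submodule.Quotient.mk_eq_zero] at hs2 hc
    apply hc
    have h1 : R x⁻¹ (R x (Submodule.Quotient.mk c)) = Submodule.Quotient.mk c := by
      rw [← End.mul_apply, ← map_mul, inv_mul_cancel₀ hx, map_one, End.one_apply]
    rw [← h1, ← hs, hs2, map_zero]
  -- a `K`-line and `[L, L]` fill the whole quasi-centralizer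
  have hfill : ∀ (c : L) (s : K →ₗ[k] L), c ∉ secondCenter k L →
      (∀ t, (Submodule.Quotient.mk (s t) : L ⧸ der k L) = R t (Submodule.Quotient.mk c)) →
      LinearMap.range s ⊔ der k L = quasiCentralizer k c := by
    intro c s hc hs
    have h1 : ∀ x, s x ∈ der k L → x = 0 := by
      intro x hx
      by_contra hx0
      exact hinj hc hx0 (hs x) (h.der_le_secondCenter hx)
    have h2 : LinearMap.range s ⊓ der k L = ⊥ := by
      rw [eq_bot_iff]
      rintro _ ⟨⟨x, rfl⟩, hx⟩
      rw [h1 x hx, map_zero]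
      exact zero_mem _
    have h3 : finrank k (LinearMap.range s) = m := by
      rw [LinearMap.finrank_range_of_inj, hK]
      rw [injective_iff_map_eq_zero]
      intro x hx
      exact h1 x (by rw [hx]; exact zero_mem _)
    have h4 := Submodule.finrank_sup_add_finrank_inf_eq (LinearMap.range s) (der k L)
    rw [h2, finrank_bot, h3] at h4
    have h5 := h.finrank_quasiCentralizer_eq hn hc
    refine Submodule.eq_of_le_of_finrank_eq (sup_le ?_ ?_) (by omega)
    · rintro _ ⟨x, rfl⟩
      exact hlift (hs x)
    · exact h.der_le_secondCenter.trans (secondCenter_le_quasiCentralizer c)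
  obtain ⟨s₁, h₁, h₁'⟩ := h.exists_section R hR ha
  obtain ⟨s₂, h₂, h₂'⟩ := h.exists_section R hR hb
  refine ⟨s₁, s₂, ?_, h₁', h₂', ?_, ?_⟩
  · intro t x y
    have h3 : s₁ (t * x) + s₂ (t * y) ∈ quasiCentralizer k (s₁ x + s₂ y) := by
      apply hlift (t := t)
      rw [Submodule.Quotient.mk_add, Submodule.Quotient.mk_add, h₁, h₁, h₂, h₂, map_mul, map_mul,
        End.mul_apply, End.mul_apply, map_add]
    by_cases hv : s₁ x + s₂ y ∈ secondCenter k L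
    · refine ⟨0, zero_mem _, ?_⟩
      have hd := hv
      rw [h.secondCenter_eq_der, ← Submodule.Quotient.mk_eq_zero] at hd
      have h4 : s₁ (t * x) + s₂ (t * y) ∈ der k L := by
        rw [← Submodule.Quotient.mk_eq_zero, Submodule.Quotient.mk_add, h₁, h₂, map_mul, map_mul,
          End.mul_apply, End.mul_apply, ← map_add, ← h₁, ← h₂, ← Submodule.Quotient.mk_add, hd,
          map_zero]
      rw [zero_lie, lie_secondCenter_der hv h4]
    · rw [h.quasiCentralizer_eq_sup hv] at h3
      obtain ⟨c, hc, u, hu, hcu⟩ := Submodule.mem_sup.1 h3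
      refine ⟨-u, neg_mem hu, ?_⟩
      rw [← hcu, lie_add, (mem_centralizer k _ c).1 hc, zero_add, neg_lie, lie_skew]
  · intro x y hx hy hxy
    have h3 := h.lie_mem_ctr_of_quasiCentralizer (hinj ha hx (h₁ x))
      (mem_quasiCentralizer_comm.1 (hlift (h₁ x))) hxy
    exact hab (h.lie_mem_ctr_of_quasiCentralizer (hinj hb hy (h₂ y))
      (mem_quasiCentralizer_comm.1 h3) (mem_quasiCentralizer_comm.1 (hlift (h₂ y))))
  · intro v
    have hv : v ∈ quasiCentralizer k a ⊔ quasiCentralizer k b := by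
      rw [h.quasiCentralizer_sup hab]
      exact Submodule.mem_top
    rw [← hfill a s₁ ha h₁, ← hfill b s₂ hb h₂] at hv
    obtain ⟨p, hp, q, hq, rfl⟩ := Submodule.mem_sup.1 hv
    obtain ⟨_, ⟨x, rfl⟩, u, hu, rfl⟩ := Submodule.mem_sup.1 hp
    obtain ⟨_, ⟨y, rfl⟩, w, hw, rfl⟩ := Submodule.mem_sup.1 hq
    refine ⟨x, y, ?_⟩
    have : s₁ x + u + (s₂ y + w) - (s₁ x + s₂ y) = u + w := by abel
    rw [this]
    exact add_mem hu hw

end Construction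

theorem two_ne_zero_of_algebra (h2 : (2 : k) ≠ 0) : (2 : K) ≠ 0 := by
  have := (map_ne_zero (algebraMap k K)).2 h2
  rwa [map_ofNat] at this

namespace IsFrame

variable {n : ℕ} {s₁ s₂ : K →ₗ[k] L}

theorem swap (f : IsFrame s₁ s₂) : IsFrame s₂ s₁ where
  lie_mul_mem t x y := by
    obtain ⟨w, hw, hwe⟩ := f.lie_mul_mem t y x
    exact ⟨w, hw, by rwa [add_comm (s₂ x), add_comm (s₂ (t * x))]⟩
  lie_one_left := f.lie_one_right
  lie_one_right := f.lie_one_left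
  lie_not_mem x y hx hy := lie_swap_not_mem_ctr (f.lie_not_mem y x hy hx)
  span v := by
    obtain ⟨x, y, hxy⟩ := f.span v
    exact ⟨y, x, by rwa [add_comm]⟩

/-- The map `c ↦ [s₁ 1, s₂ c]` from `K` to `[L, L]`. -/
def derMap (s₁ s₂ : K →ₗ[k] L) : K →ₗ[k] L := (LieAlgebra.ad k L (s₁ 1)) ∘ₗ s₂

/-- The map `c ↦ [[s₁ 1, s₂ c], x]` from `K` to the center. -/
def ctrMap (s₁ s₂ : K →ₗ[k] L) (x : L) : K →ₗ[k] L := -(LieAlgebra.ad k L x) ∘ₗ derMap s₁ s₂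

theorem derMap_apply (c : K) : derMap s₁ s₂ c = ⁅s₁ 1, s₂ c⁆ := rfl

theorem ctrMap_apply (x : L) (c : K) : ctrMap s₁ s₂ x c = ⁅derMap s₁ s₂ c, x⁆ :=
  lie_skew _ _

theorem derMap_mem (c : K) : derMap s₁ s₂ c ∈ der k L := lie_mem_der _ _

theorem ctrMap_mem (h : IsUniform k L n) (x : L) (c : K) : ctrMap s₁ s₂ x c ∈ ctr k L := by
  rw [ctrMap_apply]
  exact h.lie_mem_ctr _ (derMap_mem c) x

variable [FiniteDimensional k L]

/-- Comparing the relation `[v, t v] ∈ [[L, L], v]` for `v = s₁ x + s₂ y` and `v = s₁ x - s₂ y`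
separates the parts of it that are even and odd in `y`. -/
theorem exists_two_smul_eq (f : IsFrame s₁ s₂) (h : IsUniform k L n) {x y : K} (hx : x ≠ 0)
    (hy : y ≠ 0) (t : K) : ∃ p ∈ der k L, ∃ q ∈ der k L,
      (2 : k) • ⁅s₁ x, s₁ (t * x)⁆ = ⁅p, s₁ x⁆ ∧
      (2 : k) • (⁅s₁ x, s₂ (t * y)⁆ - ⁅s₁ (t * x), s₂ y⁆) = ⁅q, s₁ x⁆ + ⁅p, s₂ y⁆ := by
  obtain ⟨w, hw, hwe⟩ := f.lie_mul_mem t x y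
  obtain ⟨w', hw', hwe'⟩ := f.lie_mul_mem t x (-y)
  obtain ⟨u, hu, hue⟩ := f.lie_mul_mem t x 0
  obtain ⟨v, hv, hve⟩ := f.lie_mul_mem t 0 y
  simp only [mul_zero, map_zero, add_zero, zero_add] at hue hve
  simp only [mul_neg, map_neg, add_lie, lie_add, lie_neg, neg_lie] at hwe hwe'
  rw [← lie_skew (s₂ y) (s₁ (t * x))] at hwe hwe'
  refine ⟨w + w', add_mem hw hw', w - w', sub_mem hw hw', ?_, ?_⟩
  · have h1 : ⁅(2 : k) • u - (w + w'), s₁ x⁆ = ⁅(w - w') - (2 : k) • v, s₂ y⁆ := by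
      simp only [sub_lie, add_lie, ← hue, ← hve, two_smul]
      rw [← sub_eq_zero] at hwe hwe' ⊢
      have := congrArg₂ (· + ·) hwe hwe'
      simp only [add_zero] at this
      rw [← this]
      abel
    have h2 := (h.lie_eq_lie (f.lie_not_mem x y hx hy)
      (sub_mem (Submodule.smul_mem _ _ hu) (add_mem hw hw'))
      (sub_mem (sub_mem hw hw') (Submodule.smul_mem _ _ hv)) h1).1
    have h3 := mem_ctr.1 h2 (s₁ x)
    rwa [sub_lie, smul_lie, ← hue, sub_eq_zero] at h3
  · rw [← sub_eq_zero] at hwe hwe' ⊢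
    have := congrArg₂ (· - ·) hwe hwe'
    simp only [sub_zero] at this
    rw [← this]
    simp only [sub_lie, add_lie, two_smul]
    abel

/-- `[s₁ x, s₂ y]` depends only on `x y` up to an element of `[[L, L], s₁ 1]`. -/
theorem exists_cross_one (f : IsFrame s₁ s₂) (h : IsUniform k L n) (h2 : (2 : k) ≠ 0) (t y : K) :
    ∃ u ∈ der k L, ⁅s₁ 1, s₂ (t * y)⁆ - ⁅s₁ t, s₂ y⁆ = ⁅u, s₁ 1⁆ := by
  by_cases hy : y = 0
  · exact ⟨0, zero_mem _, by simp [hy]⟩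
  obtain ⟨p, hp, q, hq, h3, h4⟩ := f.exists_two_smul_eq h one_ne_zero hy t
  rw [mul_one, f.lie_one_left, smul_zero, eq_comm] at h3
  have hs : s₁ 1 ∉ secondCenter k L :=
    not_mem_secondCenter_of_lie (f.lie_not_mem 1 y one_ne_zero hy)
  have h5 := h.mem_ctr_of_lie_eq_zero hp hs h3
  rw [mem_ctr.1 h5, add_zero, mul_one] at h4
  refine ⟨(2 : k)⁻¹ • q, Submodule.smul_mem _ _ hq, ?_⟩
  rw [smul_lie, ← h4, inv_smul_smul₀ h2]

theorem lie_mul_cross (f : IsFrame s₁ s₂) (h : IsUniform k L n) (h2 : (2 : k) ≠ 0) (x t y : K) :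
    ⁅s₁ x, s₂ (t * y)⁆ = ⁅s₁ (t * x), s₂ y⁆ := by
  -- the difference lies both in `[[L, L], s₁ 1]` and in `[[L, L], s₂ 1]`
  obtain ⟨u, hu, hue⟩ := f.exists_cross_one h h2 x (t * y)
  obtain ⟨u', hu', hue'⟩ := f.exists_cross_one h h2 (t * x) y
  obtain ⟨v, hv, hve⟩ := f.swap.exists_cross_one h h2 (t * y) x
  obtain ⟨v', hv', hve'⟩ := f.swap.exists_cross_one h h2 y (t * x)
  have e1 : x * (t * y) = t * x * y := by ring
  have e2 : y * (t * x) = t * y * x := by ring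
  rw [e1] at hue
  rw [e2] at hve'
  have h3 : ⁅s₁ x, s₂ (t * y)⁆ - ⁅s₁ (t * x), s₂ y⁆ = ⁅u' - u, s₁ 1⁆ := by
    rw [sub_lie, ← hue, ← hue']; abel
  have h4 : ⁅s₁ x, s₂ (t * y)⁆ - ⁅s₁ (t * x), s₂ y⁆ = ⁅v - v', s₂ 1⁆ := by
    rw [sub_lie, ← hve, ← hve', ← lie_skew (s₂ (t * y)), ← lie_skew (s₂ y)]; abel
  have h5 := (h.lie_eq_lie (f.lie_not_mem 1 1 one_ne_zero one_ne_zero) (sub_mem hu' hu)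
    (sub_mem hv hv') (h3.symm.trans h4)).1
  rw [mem_ctr.1 h5, sub_eq_zero] at h3
  exact h3

/-- The bracket of the two lines depends only on the product of the coordinates. -/
theorem lie_cross (f : IsFrame s₁ s₂) (h : IsUniform k L n) (h2 : (2 : k) ≠ 0) (x y : K) :
    ⁅s₁ x, s₂ y⁆ = ⁅s₁ 1, s₂ (x * y)⁆ := by
  rw [f.lie_mul_cross h h2, mul_one]

theorem lie_left (f : IsFrame s₁ s₂) (h : IsUniform k L n) (h2 : (2 : k) ≠ 0) (x x' : K) :
    ⁅s₁ x, s₁ x'⁆ = 0 := by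
  by_cases hx : x = 0
  · rw [hx, map_zero, zero_lie]
  obtain ⟨p, hp, q, hq, h3, h4⟩ := f.exists_two_smul_eq h hx one_ne_zero (x' / x)
  rw [f.lie_mul_cross h h2, sub_self, smul_zero, eq_comm] at h4
  have h5 := (h.lie_add_lie (f.lie_not_mem x 1 hx one_ne_zero) hq hp h4).2
  rw [mem_ctr.1 h5, div_mul_cancel₀ _ hx] at h3
  exact (smul_eq_zero.1 h3).resolve_left h2

theorem lie_right (f : IsFrame s₁ s₂) (h : IsUniform k L n) (h2 : (2 : k) ≠ 0) (x x' : K) :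
    ⁅s₂ x, s₂ x'⁆ = 0 :=
  f.swap.lie_left h h2 x x'

theorem lie_derMap_left (f : IsFrame s₁ s₂) (h : IsUniform k L n) (h2 : (2 : k) ≠ 0) (c x : K) :
    ⁅derMap s₁ s₂ c, s₁ x⁆ = ctrMap s₁ s₂ (s₁ 1) (c * x) := by
  rw [ctrMap_apply, derMap_apply, derMap_apply, mul_comm, ← f.lie_cross h h2,
    lie_lie_of_commute (f.lie_left h h2 _ _), lie_lie_of_commute (f.lie_left h h2 _ _),
    ← lie_skew (s₂ c), ← lie_skew (s₂ c), lie_neg, lie_neg, neg_inj, leibniz_lie (s₁ 1),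
    f.lie_left h h2, zero_lie, zero_add]

theorem lie_derMap_right (f : IsFrame s₁ s₂) (h : IsUniform k L n) (h2 : (2 : k) ≠ 0) (c x : K) :
    ⁅derMap s₁ s₂ c, s₂ x⁆ = ctrMap s₁ s₂ (s₂ 1) (c * x) := by
  have key : ∀ a b d, ⁅⁅s₁ a, s₂ b⁆, s₂ d⁆ = ⁅⁅s₁ a, s₂ d⁆, s₂ b⁆ := by
    intro a b d
    rw [lie_lie, f.lie_right h h2, lie_zero, zero_sub, lie_skew]
  rw [ctrMap_apply, derMap_apply, derMap_apply, ← f.lie_cross h h2, key c x 1, f.lie_cross h h2 c,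
    mul_one]

/-- `[L, L]` is the image of `derMap` modulo the center. -/
theorem exists_sub_derMap_mem_ctr (f : IsFrame s₁ s₂) (h : IsUniform k L n) {u : L}
    (hu : u ∈ der k L) : ∃ c, u - derMap s₁ s₂ c ∈ ctr k L := by
  have hs : s₁ 1 ∉ secondCenter k L :=
    not_mem_secondCenter_of_lie (f.lie_not_mem 1 1 one_ne_zero one_ne_zero)
  rw [← h.range_ad_sup_ctr hs] at hu
  obtain ⟨_, ⟨v, rfl⟩, z, hz, rfl⟩ := Submodule.mem_sup.1 hu
  obtain ⟨x, y, hxy⟩ := f.span v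
  refine ⟨y, ?_⟩
  have h1 : LieAlgebra.ad k L (s₁ 1) v + z - derMap s₁ s₂ y =
      ⁅s₁ 1, v - (s₁ x + s₂ y)⁆ + z := by
    rw [lie_sub, lie_add, f.lie_one_left, LieAlgebra.ad_apply, derMap_apply]
    abel
  rw [h1]
  refine add_mem ?_ hz
  exact mem_quasiCentralizer_comm (k := k).1 (h.lie_mem_ctr _ hxy (s₁ 1))

theorem der_le_range (f : IsFrame s₁ s₂) (h : IsUniform k L n) (h2 : (2 : k) ≠ 0) :
    der k L ≤ LinearMap.range (derMap s₁ s₂) ⊔ (LinearMap.range (ctrMap s₁ s₂ (s₁ 1)) ⊔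
      LinearMap.range (ctrMap s₁ s₂ (s₂ 1))) := by
  have hu : ∀ u ∈ der k L, ∀ v, ⁅u, v⁆ ∈ LinearMap.range (ctrMap s₁ s₂ (s₁ 1)) ⊔
      LinearMap.range (ctrMap s₁ s₂ (s₂ 1)) := by
    intro u hu v
    obtain ⟨c, hc⟩ := f.exists_sub_derMap_mem_ctr h hu
    obtain ⟨x, y, hxy⟩ := f.span v
    have h1 := mem_ctr.1 hc v
    have h3 := h.lie_der_der (derMap_mem (s₁ := s₁) (s₂ := s₂) c) hxy
    rw [sub_lie, sub_eq_zero] at h1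
    rw [lie_sub, sub_eq_zero, lie_add, f.lie_derMap_left h h2, f.lie_derMap_right h h2] at h3
    rw [h1, h3]
    exact Submodule.add_mem_sup ⟨_, rfl⟩ ⟨_, rfl⟩
  refine der_le fun v w => ?_
  obtain ⟨x, y, hxy⟩ := f.span v
  obtain ⟨x', y', hxy'⟩ := f.span w
  have h3 : ⁅v, w⁆ = derMap s₁ s₂ (x * y' - x' * y) +
      (⁅v - (s₁ x + s₂ y), w⁆ - ⁅w - (s₁ x' + s₂ y'), s₁ x + s₂ y⁆) := by
    have h4 : derMap s₁ s₂ (x * y' - x' * y) = ⁅s₁ x + s₂ y, s₁ x' + s₂ y'⁆ := by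
      rw [map_sub, derMap_apply, derMap_apply, ← f.lie_cross h h2, ← f.lie_cross h h2, lie_add,
        add_lie, add_lie, f.lie_left h h2, f.lie_right h h2, ← lie_skew (s₂ y)]
      abel
    rw [h4, ← lie_skew (w - _), lie_sub, sub_lie]
    abel
  rw [h3]
  exact Submodule.add_mem_sup ⟨_, rfl⟩ (sub_mem (hu _ hxy _) (hu _ hxy' _))

variable (s₁ s₂) in
/-- The candidate isomorphism from `G K`. The fourth and fifth coordinates of `G K` differ from
those in which the bracket is `K`-homogeneous by the third coordinate and a factor of `2`. -/
def ofG (α : G K) : L :=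
  s₁ (α 0) + s₂ (α 1) + derMap s₁ s₂ (α 2) + ctrMap s₁ s₂ (s₁ 1) (2⁻¹ * (α 3 - α 2)) -
    ctrMap s₁ s₂ (s₂ 1) (2⁻¹ * (α 4 - α 2))

theorem ofG_lie (f : IsFrame s₁ s₂) (h : IsUniform k L n) (h2 : (2 : k) ≠ 0) (α β : G K) :
    ofG s₁ s₂ ⁅α, β⁆ = ⁅ofG s₁ s₂ α, ofG s₁ s₂ β⁆ := by
  have h2K := two_ne_zero_of_algebra (k := k) (K := K) h2
  have hcl : ∀ (x : L) (c : K) (y : L), ⁅ctrMap s₁ s₂ x c, y⁆ = 0 := fun x c y =>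
    mem_ctr.1 (ctrMap_mem h x c) y
  have hcr : ∀ (x : L) (c : K) (y : L), ⁅y, ctrMap s₁ s₂ x c⁆ = 0 := fun x c y =>
    lie_ctr (ctrMap_mem h x c) y
  have e3 : (2 : K)⁻¹ * (⁅α, β⁆ 3 - ⁅α, β⁆ 2) = α 2 * β 0 - β 2 * α 0 := by
    rw [G.bracket_three, G.bracket_two]; field_simp; ring
  have e4 : (2 : K)⁻¹ * (⁅α, β⁆ 4 - ⁅α, β⁆ 2) = β 2 * α 1 - α 2 * β 1 := by
    rw [G.bracket_four, G.bracket_two]; field_simp; ring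
  unfold ofG
  rw [e3, e4, G.bracket_zero, G.bracket_one, G.bracket_two]
  simp only [lie_add, add_lie, lie_sub, sub_lie, hcl, hcr, f.lie_left h h2, f.lie_right h h2,
    h.lie_der_der (derMap_mem _) (derMap_mem _)]
  simp only [map_sub, map_zero, ← f.lie_derMap_left h h2, ← f.lie_derMap_right h h2]
  rw [derMap_apply (α 0 * β 1), derMap_apply (α 1 * β 0), ← f.lie_cross h h2,
    mul_comm (α 1), ← f.lie_cross h h2, ← lie_skew (s₂ (α 1)) (s₁ (β 0)),
    ← lie_skew (s₁ (α 0)) (derMap s₁ s₂ _), ← lie_skew (s₂ (α 1)) (derMap s₁ s₂ _)]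
  abel

theorem eq_zero_of_ofG_eq_zero (f : IsFrame s₁ s₂) (h : IsUniform k L n) (h2 : (2 : k) ≠ 0)
    (α : G K) (hα : ofG s₁ s₂ α = 0) : α = 0 := by
  have h2K := two_ne_zero_of_algebra (k := k) (K := K) h2
  have hder : ∀ {t : K}, derMap s₁ s₂ t ∈ ctr k L → t = 0 := by
    intro t ht
    by_contra h0
    exact f.lie_not_mem 1 t one_ne_zero h0 ht
  unfold ofG at hα
  have hz := fun x c => ctrMap_mem (s₁ := s₁) (s₂ := s₂) h x c
  have h3 : s₁ (α 0) + s₂ (α 1) ∈ der k L := by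
    have : s₁ (α 0) + s₂ (α 1) = ctrMap s₁ s₂ (s₂ 1) (2⁻¹ * (α 4 - α 2)) -
        ctrMap s₁ s₂ (s₁ 1) (2⁻¹ * (α 3 - α 2)) - derMap s₁ s₂ (α 2) := by
      rw [← sub_eq_zero, ← hα]; abel
    rw [this]
    exact sub_mem (h.ctr_le (sub_mem (hz _ _) (hz _ _))) (derMap_mem _)
  have h4 := fun y => mem_quasiCentralizer_comm (k := k).1 (h.lie_mem_ctr _ h3 y)
  have h0 : α 0 = 0 := by
    by_contra h0
    have := h4 (s₂ 1)
    rw [mem_quasiCentralizer, lie_add, f.lie_one_right, add_zero] at this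
    exact lie_swap_not_mem_ctr (f.lie_not_mem _ 1 h0 one_ne_zero) this
  have h1 : α 1 = 0 := by
    have := h4 (s₁ 1)
    rw [mem_quasiCentralizer, lie_add, f.lie_one_left, zero_add] at this
    exact hder this
  rw [h0, h1, map_zero, map_zero, add_zero, zero_add] at hα
  have h5 : α 2 = 0 := by
    apply hder
    have : derMap s₁ s₂ (α 2) = ctrMap s₁ s₂ (s₂ 1) (2⁻¹ * (α 4 - α 2)) -
        ctrMap s₁ s₂ (s₁ 1) (2⁻¹ * (α 3 - α 2)) := by
      rw [← sub_eq_zero, ← hα]; abel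
    rw [this]
    exact sub_mem (hz _ _) (hz _ _)
  rw [h5, map_zero, zero_add, sub_zero, sub_zero, sub_eq_add_neg, ctrMap_apply, ctrMap_apply,
    ← neg_lie] at hα
  have h6 := h.lie_add_lie (f.lie_not_mem 1 1 one_ne_zero one_ne_zero) (derMap_mem _)
    (neg_mem (derMap_mem _)) hα
  have h7 := (mul_eq_zero.1 (hder h6.1)).resolve_left (inv_ne_zero h2K)
  have h8 := (mul_eq_zero.1 (hder (neg_mem_iff.1 h6.2))).resolve_left (inv_ne_zero h2K)
  exact G.ext_coord h0 h1 h5 h7 h8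

theorem ofG_surjective (f : IsFrame s₁ s₂) (h : IsUniform k L n) (h2 : (2 : k) ≠ 0) :
    Function.Surjective (ofG s₁ s₂) := by
  have h2K := two_ne_zero_of_algebra (k := k) (K := K) h2
  intro v
  obtain ⟨x, y, hxy⟩ := f.span v
  obtain ⟨_, ⟨c, rfl⟩, z, hz, hcz⟩ := Submodule.mem_sup.1 (f.der_le_range h h2 hxy)
  obtain ⟨_, ⟨d, rfl⟩, _, ⟨e, rfl⟩, rfl⟩ := Submodule.mem_sup.1 hz
  refine ⟨(![x, y, c, 2 * d + c, c - 2 * e] : Fin 5 → K), ?_⟩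
  have e3 : (2 : K)⁻¹ * (2 * d + c - c) = d := by field_simp; ring
  have e4 : (2 : K)⁻¹ * (c - 2 * e - c) = -e := by field_simp; ring
  change s₁ x + s₂ y + derMap s₁ s₂ c + ctrMap s₁ s₂ (s₁ 1) (2⁻¹ * (2 * d + c - c)) -
    ctrMap s₁ s₂ (s₂ 1) (2⁻¹ * (c - 2 * e - c)) = v
  rw [e3, e4, map_neg, sub_neg_eq_add, add_assoc, add_assoc, hcz]
  abel

theorem nonempty_lieEquiv (f : IsFrame s₁ s₂) (h : IsUniform k L n) (h2 : (2 : k) ≠ 0) :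
    Nonempty (L ≃ₗ⁅k⁆ G K) := by
  let F : G K →ₗ⁅k⁆ L :=
    { toFun := ofG s₁ s₂
      map_add' := fun α β => by
        have e3 : (2 : K)⁻¹ * (α 3 + β 3 - (α 2 + β 2)) =
            2⁻¹ * (α 3 - α 2) + 2⁻¹ * (β 3 - β 2) := by ring
        have e4 : (2 : K)⁻¹ * (α 4 + β 4 - (α 2 + β 2)) =
            2⁻¹ * (α 4 - α 2) + 2⁻¹ * (β 4 - β 2) := by ring
        simp only [ofG, G.add_apply, e3, e4, map_add]
        abel
      map_smul' := fun t α => by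
        simp only [ofG, G.smul_apply, ← smul_sub, mul_smul_comm, map_smul,
          RingHom.id_apply]
        simp only [smul_sub, smul_add]
      map_lie' := fun {α β} => f.ofG_lie h h2 α β }
  exact ⟨(LieEquiv.ofBijective F ⟨(injective_iff_map_eq_zero F).2 (f.eq_zero_of_ofG_eq_zero h h2),
    f.ofG_surjective h h2⟩).symm⟩

end IsFrame

end Frame

/-- For class exactly `3`, `[[L, L], L]` is central and nonzero, so `[L, L]` is not central. -/
theorem isUniform_of_hasBreadthType {k L : Type*} [Field k] [LieRing L] [LieAlgebra k L]
    [FiniteDimensional k L] (hnil : IsStepNilpotent L 3) (hstem : IsStem k L) {n : ℕ}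
    (hbreadth : HasBreadthType k L [0, n]) : IsUniform k L n := by
  have hlcs := (LieModule.nilpotencyLength_eq_succ_iff k L L 2).1 hnil.2
  have h1 : LieModule.lowerCentralSeries k L L 1 =
      ⁅(⊤ : LieIdeal k L), (⊤ : LieIdeal k L)⁆ := by
    rw [LieModule.lowerCentralSeries_succ, LieModule.lowerCentralSeries_zero]
  refine ⟨fun w hw x => ?_, hstem, ?_, fun x hx => ?_⟩
  · rw [mem_ctr]
    intro y
    have h3 : ⁅y, ⁅x, w⁆⁆ ∈ LieModule.lowerCentralSeries k L L 3 := by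
      rw [LieModule.lowerCentralSeries_succ, LieModule.lowerCentralSeries_succ, h1]
      exact LieSubmodule.lie_mem_lie (LieSubmodule.mem_top y)
        (LieSubmodule.lie_mem_lie (LieSubmodule.mem_top x) hw)
    rw [hlcs.1, LieSubmodule.mem_bot] at h3
    rw [← lie_skew, ← lie_skew w x, lie_neg, neg_neg, h3]
  · by_contra! hc
    apply hlcs.2
    rw [LieModule.lowerCentralSeries_succ, h1, eq_bot_iff, LieSubmodule.lie_le_iff]
    intro x _ w hw
    rw [LieSubmodule.mem_bot, lie_ctr (hc w hw)]
  · have h2 : breadth k x ∈ {l | l ∈ [0, n]} := hbreadth.2 ▸ Set.mem_range_self x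
    have h3 := Submodule.finrank_quotient_add_finrank (centralizer k x)
    have h4 : breadth k x = finrank k (L ⧸ centralizer k x) := rfl
    simp only [List.mem_cons, List.not_mem_nil, or_false, Set.mem_ofPred_eq] at h2
    rcases h2 with h2 | h2
    · exfalso
      apply hx
      have h5 : centralizer k x = ⊤ := Submodule.eq_top_of_finrank_eq (by omega)
      rw [mem_ctr]
      intro y
      rw [← mem_centralizer k, h5]
      exact Submodule.mem_top
    · omega

end TwoBreadth

theorem corollary1p3 {k K L : Type*} [Field k] [Finite k] (hk : ringChar k ≠ 2)
    (m : ℕ) (hm : 1 ≤ m)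
    [Field K] [Algebra k K] (hK : Module.finrank k K = m)
    [LieRing L] [LieAlgebra k L] [FiniteDimensional k L]
    (hnil : TwoBreadth.IsStepNilpotent L 3)
    (hstem : TwoBreadth.IsStem k L)
    (hbreadth : TwoBreadth.HasBreadthType k L [0, 2 * m]) :
    Nonempty (L ≃ₗ⁅k⁆ TwoBreadth.G K) := by
  have h := TwoBreadth.isUniform_of_hasBreadthType hnil hstem hbreadth
  obtain ⟨s₁, s₂, f⟩ := h.exists_isFrame rfl hm hK
  exact f.nonempty_lieEquiv h (Ring.two_ne_zero hk)
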